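/- Let $s\ge 2$ be an integer. There is a function $\delta_s\colon(0,1]\to[0,\infty)$, depending only on $s$, with $\delta_s(\eta)\to 0$ as $\eta\to 0^+$, such that the following holds. For a nonempty finite set $V$, an even integer $\ell\ge 2$ and $G\colon V^s\to\mathbb{R}$, define the $\ell$-box norm $$\|G\|_{\square_\ell(V^s)}=\Bigl(\frac{1}{|V|^{s\ell}}\sum_{x=(x_{ij})\in V^{s\times \ell}}\ \prod_{\omega\in\{1,\dots,\ell\}^s} G\bigl(x_{1\omega_1},\dots,x_{s\omega_s}\bigr)\Bigr)^{1/\ell^s},$$ and let $\|G\|_{\square(V^s)}=\|G\|_{\square_2(V^s)}$ be the box norm. Let $V$ be a nonempty finite set, let $0<\eta\le 1$, and let $\nu\colon V^s\to[0,\infty)$ satisfy $\|\nu-1\|_{\square_4(V^s)}\le\eta$. Then for every $F\colon V^s\to\mathbb{R}$ with $|F|\le\nu$ pointwise there exists $H\colon V^s\to[-1,1]$ such that $$\|F-H\|_{\square(V^s)}\le\delta_s(\eta).$$ Moreover, if $F$ is nonnegative, then $H$ can also be taken nonnegative (so $H\colon V^s\to[0,1]$). -/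

import Mathlib

universe u

open Filter Topology
open scoped BigOperators

/-- For `ω ∈ [ℓ]^s`, the projection `π_ω : V^{s × ℓ} → V^s`, `π_ω((x_{ij})) = (x_{i ω_i})_i`. -/
def boxProj {V : Type*} {s ℓ : ℕ} (ω : Fin s → Fin ℓ) (x : Fin s → Fin ℓ → V) : Fin s → V :=
  fun i => x i (ω i)

/-- The `ℓ`-box norm of `F : V^s → ℝ`, for an even integer `ℓ ≥ 2`: the `ℓ^s`-th root of the average
over `x ∈ V^{s × ℓ}` of `∏_{ω ∈ [ℓ]^s} F (π_ω x)` (this average is nonnegative for even `ℓ`). -/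
noncomputable def lBoxNorm (ℓ : ℕ) {V : Type*} [Fintype V] {s : ℕ} (F : (Fin s → V) → ℝ) : ℝ :=
  (𝔼 x : Fin s → Fin ℓ → V, ∏ ω : Fin s → Fin ℓ, F (boxProj ω x)) ^ (1 / (ℓ : ℝ) ^ s)

/-- The box norm of `F : V^s → ℝ`, that is, the `ℓ`-box norm for `ℓ = 2`. -/
noncomputable def boxNorm {V : Type*} [Fintype V] {s : ℕ} (F : (Fin s → V) → ℝ) : ℝ :=
  lBoxNorm 2 F

/-!
Both parts of the argument rest on the Gowers–Cauchy–Schwarz inequality for the `4`-box norm.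

*Dense model.* If no bounded `H` were indistinguishable from `F` by cut functions, the minimax
theorem would give one test `ψ` in their convex hull that works against every `H`. Taking for `H`
the indicator of `ψ ≥ 0` bounds the advantage of `ψ` by `𝔼 (ν - 1) ψ⁺`. This is small: cut functions
are closed under products, so polynomials in `ψ`, and by Weierstrass also `ψ⁺`, are nearly
orthogonal to `ν - 1`.

*Counting by densification.* It remains to see that a function `f`, `|f| ≤ ν`, which is nearly
orthogonal to all cut functions has small box norm. Cauchy–Schwarz replaces one factor `f` of the
box form by the dual function `D` of the other factors, up to an error: the linear forms condition
gives `𝔼 (ν - 1) D² ≈ 0` and shows that `D` is close in mean square to being `1`-bounded. Once a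
single factor `f` is left, the box form is an average of correlations of `f` with cut functions.
-/

section Averages

variable {ι α : Type*}

theorem expect_prod_type {κ : Type*} [Fintype ι] [Fintype κ] (f : ι → κ → ℝ) :
    𝔼 p : ι × κ, f p.1 p.2 = 𝔼 x, 𝔼 y, f x y := by
  rw [← Finset.univ_product_univ, Finset.expect_product]

theorem expect_expect_update [Fintype ι] [DecidableEq ι] [Fintype α] [Nonempty α] (i : ι)
    (f : (ι → α) → ℝ) : 𝔼 x : ι → α, 𝔼 z, f (Function.update x i z) = 𝔼 x, f x := by
  have swap_involutive : Function.Involutive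
      fun p : (ι → α) × α => (Function.update p.1 i p.2, p.1 i) := fun p => by simp
  calc 𝔼 x : ι → α, 𝔼 z, f (Function.update x i z)
      = 𝔼 p : (ι → α) × α, f (Function.update p.1 i p.2) := (expect_prod_type _).symm
    _ = 𝔼 p : (ι → α) × α, f p.1 :=
        Fintype.expect_bijective _ swap_involutive.bijective _ _ fun _ => rfl
    _ = 𝔼 x, f x := by rw [expect_prod_type fun x _ => f x]; simp

theorem expect_prod_apply [Fintype ι] [DecidableEq ι] [Fintype α] (f : ι → α → ℝ) :
    𝔼 z : ι → α, ∏ i, f i (z i) = ∏ i, 𝔼 a, f i a := by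
  simp only [Fintype.expect_eq_sum_div_card, Finset.prod_div_distrib, Finset.prod_univ_sum,
    Fintype.piFinset_univ, Fintype.card_pi, Nat.cast_prod]

theorem prod_add_eq_sum_prod_piecewise [Fintype ι] [DecidableEq ι] (f g : ι → ℝ) :
    ∏ i, (f i + g i) = ∑ T : Finset ι, ∏ i, T.piecewise f g i := by
  simp only [Finset.prod_add, Finset.powerset_univ, Finset.prod_piecewise, Finset.univ_inter]

theorem sq_expect_mul_le_of_abs_le [Fintype ι] {f w : ι → ℝ} (hf : ∀ x, |f x| ≤ w x)
    (g : ι → ℝ) : (𝔼 x, f x * g x) ^ 2 ≤ (𝔼 x, w x) * 𝔼 x, w x * g x ^ 2 := by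
  have hw : ∀ x, 0 ≤ w x := fun x => (abs_nonneg _).trans (hf x)
  have abs_le : |𝔼 x, f x * g x| ≤ 𝔼 x, √(w x) * (√(w x) * |g x|) := by
    refine (Finset.abs_expect_le _ _).trans (Finset.expect_le_expect fun x _ => ?_)
    rw [abs_mul, ← mul_assoc, Real.mul_self_sqrt (hw x)]
    exact mul_le_mul_of_nonneg_right (hf x) (abs_nonneg _)
  calc (𝔼 x, f x * g x) ^ 2 ≤ (𝔼 x, √(w x) * (√(w x) * |g x|)) ^ 2 :=
        sq_le_sq' (neg_le_of_abs_le abs_le) (le_of_abs_le abs_le)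
    _ ≤ (𝔼 x, √(w x) ^ 2) * 𝔼 x, (√(w x) * |g x|) ^ 2 :=
        Finset.expect_mul_sq_le_sq_mul_sq _ _ _
    _ = (𝔼 x, w x) * 𝔼 x, w x * g x ^ 2 := by
        simp only [mul_pow, Real.sq_sqrt (hw _), sq_abs]

theorem abs_prod_le_sum_pow_div {ℓ : ℕ} [NeZero ℓ] (hℓ : Even ℓ) (a : Fin ℓ → ℝ) :
    |∏ k, a k| ≤ (∑ k, a k ^ ℓ) / ℓ := by
  have hℓ₀ : (ℓ : ℝ) ≠ 0 := Nat.cast_ne_zero.2 (NeZero.ne ℓ)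
  have amgm := Real.geom_mean_le_arith_mean_weighted Finset.univ (fun _ => (ℓ : ℝ)⁻¹)
    (fun k => |a k| ^ ℓ) (fun _ _ => by positivity) (by simp [hℓ₀]) fun _ _ => by positivity
  simp only [Real.pow_rpow_inv_natCast (abs_nonneg _) (NeZero.ne ℓ), ← Finset.mul_sum] at amgm
  simpa only [Finset.abs_prod, hℓ.pow_abs, ← div_eq_inv_mul] using amgm

end Averages

section BoxForm

variable {V : Type*} [Fintype V] {s ℓ : ℕ}

/-- The multilinear form behind the `ℓ`-box norm, with one function for each vertex `ω ∈ [ℓ]^s`. -/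
noncomputable def boxForm (ℓ : ℕ) {V : Type*} [Fintype V] {s : ℕ}
    (h : (Fin s → Fin ℓ) → (Fin s → V) → ℝ) : ℝ :=
  𝔼 X : Fin s → Fin ℓ → V, ∏ ω, h ω (boxProj ω X)

theorem boxForm_smul (c : (Fin s → Fin ℓ) → ℝ) (h : (Fin s → Fin ℓ) → (Fin s → V) → ℝ) :
    boxForm ℓ (fun ω => c ω • h ω) = (∏ ω, c ω) * boxForm ℓ h := by
  simp only [boxForm, Pi.smul_apply, smul_eq_mul, Finset.prod_mul_distrib, Finset.mul_expect]

theorem boxForm_add (h h' : (Fin s → Fin ℓ) → (Fin s → V) → ℝ) :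
    boxForm ℓ (h + h') = ∑ T : Finset (Fin s → Fin ℓ), boxForm ℓ (T.piecewise h h') := by
  unfold boxForm
  rw [← Finset.expect_sum_comm]
  refine Finset.expect_congr rfl fun X _ => ?_
  simp only [Pi.add_apply, prod_add_eq_sum_prod_piecewise]
  refine Finset.sum_congr rfl fun T _ => Finset.prod_congr rfl fun ω _ => ?_
  by_cases hω : ω ∈ T <;> simp [hω]

@[simp]
theorem boxForm_one [Nonempty V] : boxForm ℓ (1 : (Fin s → Fin ℓ) → (Fin s → V) → ℝ) = 1 := by
  simp [boxForm]

@[simp]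
theorem lBoxNorm_one [Nonempty V] : lBoxNorm ℓ (1 : (Fin s → V) → ℝ) = 1 := by
  simp [lBoxNorm]

/-- The factor of the `ℓ`-box form coming from the vertices with `ω i = k`, averaged over the
variable `x_{ik}`, the only one among the `x_{i1}, …, x_{iℓ}` that it involves. -/
noncomputable def boxSlice (h : (Fin s → Fin ℓ) → (Fin s → V) → ℝ) (i : Fin s) (k : Fin ℓ)
    (X : Fin s → Fin ℓ → V) : ℝ :=
  𝔼 v : V, ∏ ω with ω i = k, h ω (boxProj ω (Function.update X i fun _ => v))

theorem boxForm_eq_expect_prod_boxSlice [Nonempty V] (h : (Fin s → Fin ℓ) → (Fin s → V) → ℝ)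
    (i : Fin s) : boxForm ℓ h = 𝔼 X, ∏ k, boxSlice h i k X := by
  rw [boxForm, ← expect_expect_update i]
  refine Finset.expect_congr rfl fun X _ => ?_
  simp only [boxSlice, ← expect_prod_apply fun k v =>
    ∏ ω with ω i = k, h ω (boxProj ω (Function.update X i fun _ => v))]
  refine Finset.expect_congr rfl fun z _ => ?_
  rw [← Finset.prod_fiberwise (s := Finset.univ) (g := fun ω : Fin s → Fin ℓ => ω i)]
  refine Finset.prod_congr rfl fun k _ => Finset.prod_congr rfl fun ω hω => ?_
  have hk : ω i = k := by simpa using hω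
  congr 1
  funext j
  rcases eq_or_ne j i with rfl | hj
  · simp [boxProj, hk]
  · simp [boxProj, hj]

theorem boxSlice_update (h : (Fin s → Fin ℓ) → (Fin s → V) → ℝ) (i : Fin s) (k k' : Fin ℓ)
    (X : Fin s → Fin ℓ → V) :
    boxSlice (fun ω => h (Function.update ω i k)) i k' X = boxSlice h i k X := by
  refine Finset.expect_congr rfl fun v _ => ?_
  refine Finset.prod_nbij' (fun ω => Function.update ω i k) (fun ω => Function.update ω i k')
    (by simp) (by simp) ?_ ?_ fun ω _ => ?_
  · rintro ω hω
    simp [← (Finset.mem_filter.1 hω).2]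
  · rintro ω hω
    simp [← (Finset.mem_filter.1 hω).2]
  · congr 1
    funext j
    rcases eq_or_ne j i with rfl | hj
    · simp [boxProj]
    · simp [boxProj, hj]

section EvenOrder

variable [Nonempty V] [NeZero ℓ] (hℓ : Even ℓ)
include hℓ

theorem abs_boxForm_le_sum_update (h : (Fin s → Fin ℓ) → (Fin s → V) → ℝ) (i : Fin s) :
    |boxForm ℓ h| ≤ (∑ k, boxForm ℓ fun ω => h (Function.update ω i k)) / ℓ := by
  simp only [boxForm_eq_expect_prod_boxSlice _ i, boxSlice_update, Finset.prod_const,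
    Finset.card_univ, Fintype.card_fin]
  rw [← Finset.expect_sum_comm, Finset.expect_div]
  exact (Finset.abs_expect_le _ _).trans
    (Finset.expect_le_expect fun X _ => abs_prod_le_sum_pow_div hℓ _)

theorem exists_abs_boxForm_le_update (h : (Fin s → Fin ℓ) → (Fin s → V) → ℝ) (i : Fin s) :
    ∃ k, |boxForm ℓ h| ≤ |boxForm ℓ fun ω => h (Function.update ω i k)| := by
  by_contra! hlt
  have hℓ₀ : (0 : ℝ) < ℓ := Nat.cast_pos.2 (NeZero.pos ℓ)
  have sum_lt : ∑ k, boxForm ℓ (fun ω => h (Function.update ω i k))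
      < ∑ _k : Fin ℓ, |boxForm ℓ h| :=
    Finset.sum_lt_sum_of_nonempty Finset.univ_nonempty fun k _ => (le_abs_self _).trans_lt (hlt k)
  refine (abs_boxForm_le_sum_update hℓ h i).not_gt ((div_lt_iff₀ hℓ₀).2 ?_)
  simpa [mul_comm] using sum_lt

theorem exists_abs_boxForm_le_const (h : (Fin s → Fin ℓ) → (Fin s → V) → ℝ) :
    ∃ ω₀, |boxForm ℓ h| ≤ |boxForm ℓ fun _ => h ω₀| := by
  suffices ∀ I : Finset (Fin s), ∃ ω₀ : Fin s → Fin ℓ,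
      |boxForm ℓ h| ≤ |boxForm ℓ fun ω => h (I.piecewise ω₀ ω)| by
    simpa only [Finset.piecewise_univ] using this Finset.univ
  intro I
  induction I using Finset.induction_on with
  | empty => exact ⟨0, by simp only [Finset.piecewise_empty, le_refl]⟩
  | insert i I hi ih =>
    obtain ⟨ω₀, hω₀⟩ := ih
    obtain ⟨k, hk⟩ := exists_abs_boxForm_le_update hℓ (fun ω => h (I.piecewise ω₀ ω)) i
    refine ⟨Function.update ω₀ i k, hω₀.trans (hk.trans_eq ?_)⟩
    congr! 4 with ω
    rw [Finset.piecewise_insert, Function.update_self,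
      ← Finset.update_piecewise_of_notMem _ _ _ hi]
    congr 1
    refine Finset.piecewise_congr _ (fun j hj => ?_) fun _ _ => rfl
    rw [Function.update_of_ne (ne_of_mem_of_not_mem hj hi)]

variable [NeZero s]

theorem boxForm_const_nonneg (F : (Fin s → V) → ℝ) : 0 ≤ boxForm ℓ fun _ => F := by
  have h := (abs_nonneg _).trans (abs_boxForm_le_sum_update hℓ (fun _ => F) 0)
  have hℓ₀ : (ℓ : ℝ) ≠ 0 := Nat.cast_ne_zero.2 (NeZero.ne ℓ)
  simpa [hℓ₀] using h

theorem lBoxNorm_nonneg (F : (Fin s → V) → ℝ) : 0 ≤ lBoxNorm ℓ F :=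
  Real.rpow_nonneg (boxForm_const_nonneg hℓ F) _

theorem lBoxNorm_pow (F : (Fin s → V) → ℝ) :
    lBoxNorm ℓ F ^ ℓ ^ s = boxForm ℓ fun _ => F := by
  have h := Real.rpow_inv_natCast_pow (boxForm_const_nonneg hℓ F) (pow_ne_zero s (NeZero.ne ℓ))
  rwa [Nat.cast_pow, ← one_div] at h

theorem lBoxNorm_le_of_boxForm_le {F : (Fin s → V) → ℝ} {c : ℝ} (hc : 0 ≤ c)
    (hF : boxForm ℓ (fun _ => F) ≤ c ^ ℓ ^ s) : lBoxNorm ℓ F ≤ c :=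
  le_of_pow_le_pow_left₀ (pow_ne_zero s (NeZero.ne ℓ)) hc ((lBoxNorm_pow hℓ F).trans_le hF)

theorem lBoxNorm_smul_of_nonneg {c : ℝ} (hc : 0 ≤ c) (F : (Fin s → V) → ℝ) :
    lBoxNorm ℓ (c • F) = c * lBoxNorm ℓ F := by
  refine (pow_left_inj₀ (lBoxNorm_nonneg hℓ _) (mul_nonneg hc (lBoxNorm_nonneg hℓ F))
    (pow_ne_zero s (NeZero.ne ℓ))).1 ?_
  rw [mul_pow, lBoxNorm_pow hℓ, lBoxNorm_pow hℓ, boxForm_smul]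
  simp

theorem lBoxNorm_zero : lBoxNorm ℓ (0 : (Fin s → V) → ℝ) = 0 := by
  simpa using lBoxNorm_smul_of_nonneg hℓ le_rfl (0 : (Fin s → V) → ℝ)

/-- **Gowers–Cauchy–Schwarz**: after normalizing every `h ω`, Hölder's inequality, applied one
coordinate at a time, bounds the form by a form with equal functions. -/
theorem abs_boxForm_le_prod_lBoxNorm (h : (Fin s → Fin ℓ) → (Fin s → V) → ℝ) :
    |boxForm ℓ h| ≤ ∏ ω, lBoxNorm ℓ (h ω) := by
  have perturbed : ∀ ε > 0, |boxForm ℓ h| ≤ ∏ ω, (lBoxNorm ℓ (h ω) + ε) := by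
    intro ε hε
    let c : (Fin s → Fin ℓ) → ℝ := fun ω => lBoxNorm ℓ (h ω) + ε
    have c_pos : ∀ ω, 0 < c ω := fun ω => add_pos_of_nonneg_of_pos (lBoxNorm_nonneg hℓ _) hε
    obtain ⟨ω₀, hω₀⟩ := exists_abs_boxForm_le_const hℓ fun ω => (c ω)⁻¹ • h ω
    have normalized : |boxForm ℓ fun ω => (c ω)⁻¹ • h ω| ≤ 1 := by
      refine hω₀.trans ?_
      rw [abs_of_nonneg (boxForm_const_nonneg hℓ _), ← lBoxNorm_pow hℓ,
        lBoxNorm_smul_of_nonneg hℓ (inv_nonneg.2 (c_pos ω₀).le)]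
      refine pow_le_one₀ (mul_nonneg (inv_nonneg.2 (c_pos ω₀).le) (lBoxNorm_nonneg hℓ _)) ?_
      rw [inv_mul_le_one₀ (c_pos ω₀)]
      exact le_add_of_nonneg_right hε.le
    rwa [boxForm_smul, Finset.prod_inv_distrib, abs_mul, abs_inv, inv_mul_le_one₀
      (abs_pos.2 (Finset.prod_ne_zero_iff.2 fun ω _ => (c_pos ω).ne')),
      abs_of_pos (Finset.prod_pos fun ω _ => c_pos ω)] at normalized
  have limit : Tendsto (fun ε => ∏ ω, (lBoxNorm ℓ (h ω) + ε)) (𝓝[>] 0)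
      (𝓝 (∏ ω, (lBoxNorm ℓ (h ω) + 0))) :=
    (Continuous.tendsto (by fun_prop) 0).mono_left nhdsWithin_le_nhds
  simpa using ge_of_tendsto limit (eventually_mem_nhdsWithin.mono perturbed)

theorem lBoxNorm_add_le (F G : (Fin s → V) → ℝ) :
    lBoxNorm ℓ (F + G) ≤ lBoxNorm ℓ F + lBoxNorm ℓ G := by
  refine lBoxNorm_le_of_boxForm_le hℓ (add_nonneg (lBoxNorm_nonneg hℓ F) (lBoxNorm_nonneg hℓ G)) ?_
  calc boxForm ℓ (fun _ => F + G)
      = ∑ T : Finset (Fin s → Fin ℓ), boxForm ℓ (T.piecewise (fun _ => F) fun _ => G) :=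
        boxForm_add (fun _ => F) fun _ => G
    _ ≤ ∑ T : Finset (Fin s → Fin ℓ),
        ∏ ω, lBoxNorm ℓ (T.piecewise (fun _ => F) (fun _ => G) ω) :=
        Finset.sum_le_sum fun T _ =>
          (le_abs_self _).trans (abs_boxForm_le_prod_lBoxNorm hℓ _)
    _ = (lBoxNorm ℓ F + lBoxNorm ℓ G) ^ ℓ ^ s := by
        have expand := prod_add_eq_sum_prod_piecewise
          (fun _ : Fin s → Fin ℓ => lBoxNorm ℓ F) fun _ => lBoxNorm ℓ G
        simp only [Finset.prod_const, Finset.card_univ, Fintype.card_pi, Fintype.card_fin] at expand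
        rw [expand]
        refine Finset.sum_congr rfl fun T _ => Finset.prod_congr rfl fun ω _ => ?_
        by_cases hω : ω ∈ T <;> simp [hω]

theorem lBoxNorm_le_of_abs_le {F w : (Fin s → V) → ℝ} (hF : ∀ v, |F v| ≤ w v) :
    lBoxNorm ℓ F ≤ lBoxNorm ℓ w := by
  refine lBoxNorm_le_of_boxForm_le hℓ (lBoxNorm_nonneg hℓ w) ?_
  rw [lBoxNorm_pow hℓ]
  refine Finset.expect_le_expect fun X _ => (le_abs_self _).trans ?_
  rw [Finset.abs_prod]
  exact Finset.prod_le_prod (fun _ _ => abs_nonneg _) fun ω _ => hF _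

theorem lBoxNorm_le_one_add {w : (Fin s → V) → ℝ} {η : ℝ} (hw : lBoxNorm ℓ (w - 1) ≤ η) :
    lBoxNorm ℓ w ≤ 1 + η := by
  have h := lBoxNorm_add_le hℓ 1 (w - 1)
  rw [add_sub_cancel, lBoxNorm_one] at h
  linarith

theorem abs_boxForm_sub_one_le {p : (Fin s → Fin ℓ) → (Fin s → V) → ℝ} {η : ℝ}
    (hp : ∀ ω, lBoxNorm ℓ (p ω - 1) ≤ η) : |boxForm ℓ p - 1| ≤ (1 + η) ^ ℓ ^ s - 1 := by
  have expand_form := boxForm_add (p - 1) 1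
  have expand_pow := prod_add_eq_sum_prod_piecewise (fun _ : Fin s → Fin ℓ => η) fun _ => 1
  simp only [Finset.prod_const, Finset.card_univ, Fintype.card_pi, Fintype.card_fin] at expand_pow
  rw [sub_add_cancel, ← Finset.add_sum_erase _ _ (Finset.mem_univ ∅), Finset.piecewise_empty,
    boxForm_one] at expand_form
  rw [← Finset.add_sum_erase _ _ (Finset.mem_univ ∅), Finset.piecewise_empty,
    Finset.prod_const_one] at expand_pow
  rw [expand_form, add_comm 1 η, expand_pow, add_sub_cancel_left, add_sub_cancel_left]
  refine (Finset.abs_sum_le_sum_abs _ _).trans (Finset.sum_le_sum fun T _ => ?_)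
  refine (abs_boxForm_le_prod_lBoxNorm hℓ _).trans
    (Finset.prod_le_prod (fun _ _ => lBoxNorm_nonneg hℓ _) fun ω _ => ?_)
  by_cases hω : ω ∈ T <;> simp [hω, hp]

end EvenOrder

end BoxForm

section Subsystems

variable {V J : Type*} [Fintype V] [Fintype J] {s ℓ : ℕ} {σ : J → Fin s → Fin ℓ}

theorem expect_prod_boxProj (hσ : Function.Injective σ) (f : J → (Fin s → V) → ℝ) :
    𝔼 X, ∏ j, f j (boxProj (σ j) X) = boxForm ℓ (Function.extend σ f 1) := by
  refine Finset.expect_congr rfl fun X _ => Fintype.prod_of_injective σ hσ _ _ (fun ω hω => ?_)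
    fun j => ?_
  · rw [Function.extend_apply' _ _ _ hω]
    rfl
  · rw [hσ.extend_apply]

variable [Nonempty V] [NeZero ℓ] [NeZero s] (hℓ : Even ℓ) (hσ : Function.Injective σ)
  {f : J → (Fin s → V) → ℝ}
include hℓ hσ

theorem abs_expect_prod_boxProj_le :
    |𝔼 X, ∏ j, f j (boxProj (σ j) X)| ≤ ∏ j, lBoxNorm ℓ (f j) := by
  rw [expect_prod_boxProj hσ]
  refine (abs_boxForm_le_prod_lBoxNorm hℓ _).trans_eq
    (Fintype.prod_of_injective σ hσ _ _ (fun ω hω => ?_) fun j => ?_).symm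
  · rw [Function.extend_apply' _ _ _ hω]
    exact lBoxNorm_one
  · rw [hσ.extend_apply]

theorem abs_expect_prod_boxProj_sub_one_le {η : ℝ} (hη : 0 ≤ η)
    (hf : ∀ j, lBoxNorm ℓ (f j - 1) ≤ η) :
    |𝔼 X, ∏ j, f j (boxProj (σ j) X) - 1| ≤ (1 + η) ^ ℓ ^ s - 1 := by
  rw [expect_prod_boxProj hσ]
  refine abs_boxForm_sub_one_le hℓ fun ω => ?_
  by_cases hω : ∃ j, σ j = ω
  · obtain ⟨j, rfl⟩ := hω
    rw [hσ.extend_apply]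
    exact hf j
  · rw [Function.extend_apply' _ _ _ hω]
    exact (congrArg _ (sub_self 1)).trans_le ((lBoxNorm_zero hℓ).trans_le hη)

end Subsystems

section DualFunctions

variable {V : Type*} {s : ℕ}

/-- The point of `V^s` whose coordinates are taken from `x` where `ω` agrees with the base vertex
`τ`, and from `y` elsewhere. -/
def boxMix (τ ω : Fin s → Fin 2) (x y : Fin s → V) : Fin s → V :=
  fun i => if ω i = τ i then x i else y i

variable [Fintype V]

/-- The dual function of the box form at the vertex `τ` of `[2]^s`: the average of the product of
the functions `h ω` at all other vertices, as a function of the point at `τ`. -/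
noncomputable def boxDual (τ : Fin s → Fin 2) (h : (Fin s → Fin 2) → (Fin s → V) → ℝ)
    (x : Fin s → V) : ℝ :=
  𝔼 y, ∏ ω : {ω // ω ≠ τ}, h ω (boxMix τ ω x y)

theorem boxForm_two_eq_expect_mul_boxDual (τ : Fin s → Fin 2)
    (h : (Fin s → Fin 2) → (Fin s → V) → ℝ) :
    boxForm 2 h = 𝔼 x, h τ x * boxDual τ h x := by
  let e : (Fin s → Fin 2 → V) ≃ (Fin s → V) × (Fin s → V) :=
    { toFun := fun X => (fun i => X i (τ i), fun i => X i (τ i + 1))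
      invFun := fun p i k => if k = τ i then p.1 i else p.2 i
      left_inv := fun X => by
        funext i k
        have add_one_eq : ∀ k t : Fin 2, k ≠ t → t + 1 = k := by decide
        by_cases hk : k = τ i
        · simp [hk]
        · simp [hk, add_one_eq k (τ i) hk]
      right_inv := fun p => by simp }
  simp only [boxDual, Finset.mul_expect]
  rw [← expect_prod_type]
  refine Fintype.expect_equiv e _ _ fun X => ?_
  rw [Fintype.prod_eq_mul_prod_subtype_ne _ τ]
  congr 1
  refine Finset.prod_congr rfl fun ω _ => congrArg (h ω) (funext fun i => ?_)
  exact (congrFun₂ (e.left_inv X) i (ω.1 i)).symm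

theorem boxDual_update (τ : Fin s → Fin 2) (h : (Fin s → Fin 2) → (Fin s → V) → ℝ)
    (g : (Fin s → V) → ℝ) : boxDual τ (Function.update h τ g) = boxDual τ h := by
  funext x
  refine Finset.expect_congr rfl fun y _ => Finset.prod_congr rfl fun ω _ => ?_
  rw [Function.update_of_ne ω.2]

theorem abs_boxDual_le {h w : (Fin s → Fin 2) → (Fin s → V) → ℝ}
    (hh : ∀ ω v, |h ω v| ≤ w ω v) (τ : Fin s → Fin 2) (x : Fin s → V) :
    |boxDual τ h x| ≤ boxDual τ w x := by
  refine (Finset.abs_expect_le _ _).trans (Finset.expect_le_expect fun y _ => ?_)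
  rw [Finset.abs_prod]
  exact Finset.prod_le_prod (fun _ _ => abs_nonneg _) fun ω _ => hh _ _

/-- The vertices of `[4]^s` carrying the factors of `g · D_a · D_b`, for two dual functions `D_a`,
`D_b` at `τ`: column `0` holds the common argument, column `1` the variables averaged in `D_a`, and
column `2` those averaged in `D_b`. -/
def dualPairVertex (τ : Fin s → Fin 2) :
    Option ({ω // ω ≠ τ} ⊕ {ω // ω ≠ τ}) → Fin s → Fin 4
  | none => fun _ => 0
  | some (.inl ω) => fun i => if ω.1 i = τ i then 0 else 1
  | some (.inr ω) => fun i => if ω.1 i = τ i then 0 else 2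

theorem dualPairVertex_injective (τ : Fin s → Fin 2) :
    Function.Injective (dualPairVertex τ) := by
  have exists_ne (ω : {ω // ω ≠ τ}) : ∃ i, ω.1 i ≠ τ i := Function.ne_iff.1 ω.2
  have eq_of_iff (ω ω' : {ω // ω ≠ τ}) (h : ∀ i, ω.1 i = τ i ↔ ω'.1 i = τ i) : ω = ω' :=
    Subtype.ext (funext fun i => by grind)
  rintro (_ | ω | ω) (_ | ω' | ω') h <;> replace h := congrFun h <;>
    simp only [dualPairVertex] at h
  case some.inl.some.inl | some.inr.some.inr => rw [eq_of_iff ω ω' fun i => by grind]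
  all_goals grind

theorem expect_three_columns (G : (Fin s → V) → (Fin s → V) → (Fin s → V) → ℝ) [Nonempty V] :
    𝔼 X : Fin s → Fin 4 → V, G (fun i => X i 0) (fun i => X i 1) (fun i => X i 2)
      = 𝔼 x, 𝔼 y, 𝔼 z, G x y z := by
  let e : (Fin s → Fin 4 → V) ≃ (Fin s → V) × (Fin s → V) × (Fin s → V) × (Fin s → V) :=
    { toFun := fun X => (fun i => X i 0, fun i => X i 1, fun i => X i 2, fun i => X i 3)
      invFun := fun p i => ![p.1 i, p.2.1 i, p.2.2.1 i, p.2.2.2 i]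
      left_inv := fun X => by funext i k; fin_cases k <;> rfl
      right_inv := fun p => rfl }
  refine (Fintype.expect_equiv e _ (fun p => G p.1 p.2.1 p.2.2.1) fun X => rfl).trans ?_
  rw [expect_prod_type fun x (p : (Fin s → V) × (Fin s → V) × (Fin s → V)) => G x p.1 p.2.1]
  refine Finset.expect_congr rfl fun x _ => ?_
  rw [expect_prod_type fun y (p : (Fin s → V) × (Fin s → V)) => G x y p.1]
  refine Finset.expect_congr rfl fun y _ => ?_
  rw [expect_prod_type fun z (_ : Fin s → V) => G x y z]
  simp only [Fintype.expect_const]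

theorem expect_mul_boxDual_mul_boxDual [Nonempty V] (τ : Fin s → Fin 2) (g : (Fin s → V) → ℝ)
    (a b : (Fin s → Fin 2) → (Fin s → V) → ℝ) :
    𝔼 x, g x * boxDual τ a x * boxDual τ b x
      = 𝔼 X, ∏ j : Option ({ω // ω ≠ τ} ⊕ {ω // ω ≠ τ}),
          j.elim g (Sum.elim (a ·) (b ·)) (boxProj (dualPairVertex τ j) X) := by
  simp only [boxDual, Finset.mul_expect, Finset.expect_mul]
  rw [Finset.expect_congr rfl fun x _ => Finset.expect_comm _ _ _, ← expect_three_columns]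
  refine Finset.expect_congr rfl fun X _ => ?_
  rw [Fintype.prod_option, Fintype.prod_sum_type, ← mul_assoc]
  congr! 5
  · exact funext fun i => (apply_ite (X i) _ _ _).symm
  · exact funext fun i => (apply_ite (X i) _ _ _).symm

@[simp]
theorem boxDual_one [Nonempty V] (τ : Fin s → Fin 2) (x : Fin s → V) :
    boxDual τ (1 : (Fin s → Fin 2) → (Fin s → V) → ℝ) x = 1 := by
  simp [boxDual]

variable [Nonempty V] [NeZero s] (τ : Fin s → Fin 2) {g : (Fin s → V) → ℝ}
  {a b : (Fin s → Fin 2) → (Fin s → V) → ℝ} {η : ℝ}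

theorem abs_expect_mul_boxDual_mul_boxDual_le (g : (Fin s → V) → ℝ)
    (a b : (Fin s → Fin 2) → (Fin s → V) → ℝ) :
    |𝔼 x, g x * boxDual τ a x * boxDual τ b x| ≤ lBoxNorm 4 g *
      ((∏ ω : {ω // ω ≠ τ}, lBoxNorm 4 (a ω)) * ∏ ω : {ω // ω ≠ τ}, lBoxNorm 4 (b ω)) := by
  rw [expect_mul_boxDual_mul_boxDual]
  refine (abs_expect_prod_boxProj_le (by decide) (dualPairVertex_injective τ)).trans_eq ?_
  rw [Fintype.prod_option, Fintype.prod_sum_type]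
  rfl

/-- The error in the linear forms condition: it bounds `|𝔼 ∏ ν - 1|` for products of copies of `ν`
at distinct vertices of `[4]^s`, when `‖ν - 1‖_{□₄} ≤ η`. -/
noncomputable def linearFormsErr (s : ℕ) (η : ℝ) : ℝ := (1 + η) ^ 4 ^ s - 1

theorem abs_expect_mul_boxDual_mul_boxDual_sub_one_le (hη : 0 ≤ η)
    (hg : lBoxNorm 4 (g - 1) ≤ η) (ha : ∀ ω, lBoxNorm 4 (a ω - 1) ≤ η)
    (hb : ∀ ω, lBoxNorm 4 (b ω - 1) ≤ η) :
    |𝔼 x, g x * boxDual τ a x * boxDual τ b x - 1| ≤ linearFormsErr s η := by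
  rw [expect_mul_boxDual_mul_boxDual]
  refine abs_expect_prod_boxProj_sub_one_le (by decide) (dualPairVertex_injective τ) hη ?_
  rintro (_ | ω | ω)
  exacts [hg, ha ω, hb ω]

theorem boxNorm_le_lBoxNorm_four (F : (Fin s → V) → ℝ) : boxNorm F ≤ lBoxNorm 4 F := by
  refine lBoxNorm_le_of_boxForm_le even_two (lBoxNorm_nonneg (by decide) F) ?_
  have h := abs_expect_mul_boxDual_mul_boxDual_le 0 F (fun _ => F) 1
  simp only [boxDual_one, mul_one, Pi.one_apply, lBoxNorm_one, Finset.prod_const_one] at h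
  rw [boxForm_two_eq_expect_mul_boxDual 0]
  refine ((le_abs_self _).trans h).trans_eq ?_
  rw [← Fintype.prod_eq_mul_prod_subtype_ne (fun _ => lBoxNorm 4 F)]
  simp

theorem abs_expect_mul_boxDual_sq_le {h w : (Fin s → Fin 2) → (Fin s → V) → ℝ}
    (hg : lBoxNorm 4 g ≤ η) (hh : ∀ ω v, |h ω v| ≤ w ω v)
    (hw : ∀ ω, lBoxNorm 4 (w ω - 1) ≤ η) :
    |𝔼 x, g x * boxDual τ h x ^ 2| ≤ linearFormsErr s η := by
  have hη : 0 ≤ η := (lBoxNorm_nonneg (by decide) g).trans hg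
  set m := Fintype.card {ω // ω ≠ τ}
  have card_le : m + m + 1 ≤ 4 ^ s := by
    simpa only [Fintype.card_option, Fintype.card_sum, Fintype.card_pi, Fintype.card_fin,
      Finset.prod_const, Finset.card_univ] using
      Fintype.card_le_of_injective _ (dualPairVertex_injective τ)
  have prod_le : ∏ ω : {ω // ω ≠ τ}, lBoxNorm 4 (h ω) ≤ (1 + η) ^ m := by
    simp only [m, ← Finset.card_univ, ← Finset.prod_const]
    exact Finset.prod_le_prod (fun _ _ => lBoxNorm_nonneg (by decide) _) fun ω _ =>
      (lBoxNorm_le_of_abs_le (by decide) (hh ω)).trans (lBoxNorm_le_one_add (by decide) (hw ω))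
  have prod_nonneg : 0 ≤ ∏ ω : {ω // ω ≠ τ}, lBoxNorm 4 (h ω) :=
    Finset.prod_nonneg fun _ _ => lBoxNorm_nonneg (by decide) _
  have bound := abs_expect_mul_boxDual_mul_boxDual_le τ g h h
  simp only [mul_assoc, ← sq] at bound
  calc |𝔼 x, g x * boxDual τ h x ^ 2| ≤ η * ((1 + η) ^ m) ^ 2 := bound.trans (by gcongr)
    _ = (1 + η) ^ (m + m + 1) - (1 + η) ^ (m + m) := by ring
    _ ≤ linearFormsErr s η := sub_le_sub (pow_le_pow_right₀ (by linarith) card_le)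
        (one_le_pow₀ (by linarith))

theorem expect_boxDual_sub_one_sq_le (hη : 0 ≤ η) (ha : ∀ ω, lBoxNorm 4 (a ω - 1) ≤ η) :
    𝔼 x, (boxDual τ a x - 1) ^ 2 ≤ 3 * linearFormsErr s η := by
  have one_close : lBoxNorm 4 ((1 : (Fin s → V) → ℝ) - 1) ≤ η := by
    rwa [sub_self, lBoxNorm_zero (by decide)]
  have second_moment := abs_expect_mul_boxDual_mul_boxDual_sub_one_le τ hη one_close ha ha
  have mean := abs_expect_mul_boxDual_mul_boxDual_sub_one_le (b := 1) τ hη one_close ha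
    fun _ => one_close
  simp only [boxDual_one, Pi.one_apply, one_mul, mul_one, ← sq] at second_moment mean
  have expand : 𝔼 x, (boxDual τ a x - 1) ^ 2
      = 𝔼 x, boxDual τ a x ^ 2 - 2 * 𝔼 x, boxDual τ a x + 1 := by
    simp only [sub_sq, mul_one, one_pow, Finset.expect_add_distrib, Finset.expect_sub_distrib,
      ← Finset.mul_expect, Fintype.expect_const]
  linarith [(abs_le.1 second_moment).2, (abs_le.1 mean).1]

end DualFunctions

section CutFunctions

variable {V : Type*} {s : ℕ}

/-- The cut functions on `V^s`: products of `1`-bounded functions `u i`, where `u i` does not depend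
on the `i`-th coordinate. -/
def cutFunctions (V : Type*) (s : ℕ) : Submonoid ((Fin s → V) → ℝ) where
  carrier := {φ | ∃ u : Fin s → (Fin s → V) → ℝ, (∀ i v, |u i v| ≤ 1) ∧
    (∀ i v z, u i (Function.update v i z) = u i v) ∧ φ = ∏ i, u i}
  mul_mem' := by
    rintro _ _ ⟨u, hu, hu', rfl⟩ ⟨w, hw, hw', rfl⟩
    refine ⟨u * w, fun i v => ?_, fun i v z => ?_, ?_⟩
    · simpa only [Pi.mul_apply, abs_mul] using mul_le_one₀ (hu i v) (abs_nonneg _) (hw i v)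
    · simp only [Pi.mul_apply, hu', hw']
    · simp only [Pi.mul_apply, Finset.prod_mul_distrib]
  one_mem' := ⟨1, by simp, by simp, by simp⟩

theorem abs_le_one_of_mem_cutFunctions {φ : (Fin s → V) → ℝ} (hφ : φ ∈ cutFunctions V s)
    (v : Fin s → V) : |φ v| ≤ 1 := by
  obtain ⟨u, hu, -, rfl⟩ := hφ
  rw [Finset.prod_apply, Finset.abs_prod]
  exact Finset.prod_le_one (fun _ _ => abs_nonneg _) fun i _ => hu i v

theorem mem_cutFunctions_of_apply_update_eq {φ : (Fin s → V) → ℝ} (i : Fin s)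
    (hφ : ∀ v, |φ v| ≤ 1) (hi : ∀ v z, φ (Function.update v i z) = φ v) :
    φ ∈ cutFunctions V s := by
  refine ⟨Pi.mulSingle i φ, fun j v => ?_, fun j v z => ?_, (Fintype.prod_pi_mulSingle' i φ).symm⟩
  · rcases eq_or_ne j i with rfl | hj
    · simpa using hφ v
    · simp [hj]
  · rcases eq_or_ne j i with rfl | hj
    · simpa using hi v z
    · simp [hj]

theorem neg_mem_cutFunctions [NeZero s] {φ : (Fin s → V) → ℝ} (hφ : φ ∈ cutFunctions V s) :
    -φ ∈ cutFunctions V s := by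
  have neg_one_mem : -1 ∈ cutFunctions V s :=
    mem_cutFunctions_of_apply_update_eq 0 (by simp) (by simp)
  simpa using mul_mem neg_one_mem hφ

theorem prod_boxMix_mem_cutFunctions (τ : Fin s → Fin 2) {h : (Fin s → Fin 2) → (Fin s → V) → ℝ}
    (hh : ∀ ω ≠ τ, ∀ v, |h ω v| ≤ 1) (y : Fin s → V) :
    (∏ ω : {ω // ω ≠ τ}, fun x => h ω (boxMix τ ω x y)) ∈ cutFunctions V s := by
  refine prod_mem fun ω _ => ?_
  obtain ⟨i, hi⟩ := Function.ne_iff.1 ω.2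
  refine mem_cutFunctions_of_apply_update_eq i (fun v => hh ω ω.2 _) fun v z => ?_
  refine congrArg (h ω) (funext fun j => ?_)
  rcases eq_or_ne j i with rfl | hj
  · simp only [boxMix, if_neg hi]
  · simp only [boxMix, Function.update_of_ne hj]

variable [Fintype V]

theorem exists_boxDual_eq_of_mem_cutFunctions [Nonempty V] {φ : (Fin s → V) → ℝ}
    (hφ : φ ∈ cutFunctions V s) : ∃ a, (∀ ω v, |a ω v| ≤ 1) ∧ boxDual 0 a = φ := by
  obtain ⟨u, hu, hu', rfl⟩ := hφ
  let a : (Fin s → Fin 2) → (Fin s → V) → ℝ := fun ω =>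
    ∏ i, if ω = Pi.single i 1 then u i else 1
  refine ⟨a, fun ω v => ?_, funext fun x => ?_⟩
  · simp only [a, Finset.prod_apply, Finset.abs_prod]
    refine Finset.prod_le_one (fun _ _ => abs_nonneg _) fun i _ => ?_
    split_ifs
    · exact hu i v
    · simp
  have prod_eq (y : Fin s → V) :
      ∏ ω : {ω : Fin s → Fin 2 // ω ≠ 0}, a ω (boxMix 0 ω x y) = ∏ i, u i x := by
    simp only [a, Finset.prod_apply]
    rw [Finset.prod_comm]
    refine Finset.prod_congr rfl fun i _ => ?_
    have single_ne : (Pi.single i 1 : Fin s → Fin 2) ≠ 0 := by simp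
    rw [Fintype.prod_eq_single ⟨Pi.single i 1, single_ne⟩ fun ω hω => by
      rw [if_neg fun h => hω (Subtype.ext h), Pi.one_apply], if_pos rfl, ← hu' i x (y i)]
    refine congrArg (u i) (funext fun j => ?_)
    rcases eq_or_ne j i with rfl | hj
    · simp [boxMix]
    · simp [boxMix, hj]
  simp only [boxDual, prod_eq, Fintype.expect_const, Finset.prod_apply]

theorem abs_expect_mul_le_of_mem_cutFunctions [Nonempty V] [NeZero s] (f : (Fin s → V) → ℝ)
    {φ : (Fin s → V) → ℝ} (hφ : φ ∈ cutFunctions V s) : |𝔼 v, f v * φ v| ≤ lBoxNorm 4 f := by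
  obtain ⟨a, ha, rfl⟩ := exists_boxDual_eq_of_mem_cutFunctions hφ
  have h := abs_expect_mul_boxDual_mul_boxDual_le 0 f a 1
  simp only [boxDual_one, mul_one, Pi.one_apply, lBoxNorm_one, Finset.prod_const_one] at h
  refine h.trans (mul_le_of_le_one_right (lBoxNorm_nonneg (by decide) f) ?_)
  refine Finset.prod_le_one (fun _ _ => lBoxNorm_nonneg (by decide) _) fun ω _ => ?_
  exact (lBoxNorm_le_of_abs_le (w := 1) (by decide) (ha ω)).trans_eq lBoxNorm_one

theorem abs_boxForm_two_le_of_cut [Nonempty V] {h : (Fin s → Fin 2) → (Fin s → V) → ℝ}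
    (τ : Fin s → Fin 2) (hh : ∀ ω ≠ τ, ∀ v, |h ω v| ≤ 1) {ε : ℝ}
    (hε : ∀ φ ∈ cutFunctions V s, |𝔼 v, h τ v * φ v| ≤ ε) : |boxForm 2 h| ≤ ε := by
  rw [boxForm_two_eq_expect_mul_boxDual τ]
  simp only [boxDual, Finset.mul_expect]
  rw [Finset.expect_comm]
  refine (Finset.abs_expect_le _ _).trans (Finset.expect_le Finset.univ_nonempty fun y _ => ?_)
  simpa only [Finset.prod_apply] using hε _ (prod_boxMix_mem_cutFunctions τ hh y)

end CutFunctions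

section Counting

/-- The nearest point of `[-1, 1]`, used to replace a dual function by a bounded one. -/
noncomputable def truncate (t : ℝ) : ℝ := max (-1) (min t 1)

theorem abs_truncate_le (t : ℝ) : |truncate t| ≤ 1 :=
  abs_le.2 ⟨le_max_left _ _, max_le (by norm_num) (min_le_right _ _)⟩

theorem abs_sub_truncate_le {t m : ℝ} (h : |t| ≤ m) : |t - truncate t| ≤ |m - 1| := by
  obtain ⟨neg_le, le⟩ := abs_le.1 h
  grind [truncate]

theorem expect_mul_sub_truncate_le {ι : Type*} [Fintype ι] [Nonempty ι] {D W : ι → ℝ} {c : ℝ}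
    (hD : ∀ x, |D x| ≤ W x) (hW : 𝔼 x, (W x - 1) ^ 2 ≤ c) :
    𝔼 x, D x * (D x - truncate (D x)) ≤ √c + c := by
  have expect_abs_le : 𝔼 x, |W x - 1| ≤ √c := by
    refine Real.le_sqrt_of_sq_le (le_trans ?_ hW)
    simpa using Finset.expect_mul_sq_le_sq_mul_sq Finset.univ (fun x => |W x - 1|) 1
  refine le_trans ?_ (add_le_add expect_abs_le hW)
  rw [← Finset.expect_add_distrib]
  refine Finset.expect_le_expect fun x _ => ?_
  calc D x * (D x - truncate (D x)) ≤ |D x| * |D x - truncate (D x)| :=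
        (le_abs_self _).trans_eq (abs_mul _ _)
    _ ≤ W x * |W x - 1| := mul_le_mul (hD x) (abs_sub_truncate_le (hD x)) (abs_nonneg _)
        ((abs_nonneg _).trans (hD x))
    _ = |W x - 1| + (W x - 1) * |W x - 1| := by ring
    _ ≤ |W x - 1| + (W x - 1) ^ 2 := by
        rw [← sq_abs (W x - 1), sq]
        gcongr
        exact le_abs_self _

/-- The error made in one densification step, when `‖ν - 1‖_{□₄} ≤ η`. -/
noncomputable def densifyErr (s : ℕ) (η : ℝ) : ℝ :=
  linearFormsErr s η + √(3 * linearFormsErr s η) + 3 * linearFormsErr s η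

/-- The error after `k` densification steps, starting from functions whose correlation with cut
functions is at most `ε`. -/
noncomputable def countErr (s : ℕ) (ε η : ℝ) : ℕ → ℝ
  | 0 => ε
  | k + 1 => √((1 + η) * (countErr s ε η k + densifyErr s η))

variable {V : Type*} [Fintype V] [Nonempty V] {s : ℕ} [NeZero s] {ν f : (Fin s → V) → ℝ}
  {η ε : ℝ}

theorem expect_mul_boxDual_sq_le (hν : lBoxNorm 4 (ν - 1) ≤ η)
    {h w : (Fin s → Fin 2) → (Fin s → V) → ℝ} (hh : ∀ ω v, |h ω v| ≤ w ω v)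
    (hw : ∀ ω, lBoxNorm 4 (w ω - 1) ≤ η) (τ : Fin s → Fin 2) :
    𝔼 x, ν x * boxDual τ h x ^ 2 ≤
      𝔼 x, truncate (boxDual τ h x) * boxDual τ h x + densifyErr s η := by
  have hη : 0 ≤ η := (lBoxNorm_nonneg (by decide) _).trans hν
  have drop_weight := (abs_le.1 (abs_expect_mul_boxDual_sq_le τ hν hh hw)).2
  have truncation := expect_mul_sub_truncate_le (abs_boxDual_le hh τ)
    (expect_boxDual_sub_one_sq_le τ hη hw)
  have decomp : 𝔼 x, ν x * boxDual τ h x ^ 2 = 𝔼 x, (ν - 1) x * boxDual τ h x ^ 2 +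
      (𝔼 x, truncate (boxDual τ h x) * boxDual τ h x +
        𝔼 x, boxDual τ h x * (boxDual τ h x - truncate (boxDual τ h x))) := by
    rw [← Finset.expect_add_distrib, ← Finset.expect_add_distrib]
    refine Finset.expect_congr rfl fun x _ => ?_
    rw [Pi.sub_apply, Pi.one_apply]
    ring
  rw [decomp, densifyErr]
  linarith

theorem expect_le_one_add (hν : lBoxNorm 4 (ν - 1) ≤ η) : 𝔼 v, ν v ≤ 1 + η := by
  have h := (abs_expect_mul_le_of_mem_cutFunctions (ν - 1) (one_mem (cutFunctions V s))).trans hν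
  simp only [Pi.sub_apply, Pi.one_apply, mul_one, Finset.expect_sub_distrib,
    Fintype.expect_const] at h
  linarith [(abs_le.1 h).2]

theorem sq_boxForm_two_le (hν : lBoxNorm 4 (ν - 1) ≤ η)
    {h w : (Fin s → Fin 2) → (Fin s → V) → ℝ} (hh : ∀ ω v, |h ω v| ≤ w ω v)
    (hw : ∀ ω, lBoxNorm 4 (w ω - 1) ≤ η) {τ : Fin s → Fin 2} (hτ : ∀ v, |h τ v| ≤ ν v) :
    boxForm 2 h ^ 2 ≤ (1 + η) *
      (boxForm 2 (Function.update h τ fun x => truncate (boxDual τ h x)) + densifyErr s η) := by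
  rw [boxForm_two_eq_expect_mul_boxDual τ h, boxForm_two_eq_expect_mul_boxDual τ
    (Function.update h τ _), boxDual_update, Function.update_self]
  refine (sq_expect_mul_le_of_abs_le hτ _).trans (mul_le_mul (expect_le_one_add hν)
    (expect_mul_boxDual_sq_le hν hh hw τ) ?_ ?_)
  · exact Finset.expect_nonneg fun x _ => mul_nonneg ((abs_nonneg _).trans (hτ x)) (sq_nonneg _)
  · linarith [(lBoxNorm_nonneg (by decide) _).trans hν]

theorem abs_boxForm_two_le_countErr (hν : lBoxNorm 4 (ν - 1) ≤ η) (hf : ∀ v, |f v| ≤ ν v)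
    (hε : ∀ φ ∈ cutFunctions V s, |𝔼 v, f v * φ v| ≤ ε) {k : ℕ} {A : Finset (Fin s → Fin 2)}
    (hA : A.card = k + 1) {h : (Fin s → Fin 2) → (Fin s → V) → ℝ} (hmem : ∀ ω ∈ A, h ω = f)
    (hnotMem : ∀ ω ∉ A, ∀ v, |h ω v| ≤ 1) : |boxForm 2 h| ≤ countErr s ε η k := by
  induction k generalizing A h with
  | zero =>
    obtain ⟨τ, rfl⟩ := Finset.card_eq_one.1 hA
    refine abs_boxForm_two_le_of_cut τ (fun ω hω => hnotMem ω (by simpa using hω)) ?_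
    rwa [hmem τ (Finset.mem_singleton_self τ)]
  | succ k ih =>
    obtain ⟨τ, hτ⟩ : A.Nonempty := Finset.card_pos.1 (by omega)
    let w : (Fin s → Fin 2) → (Fin s → V) → ℝ := fun ω => if ω ∈ A then ν else 1
    have hhw ω v : |h ω v| ≤ w ω v := by
      by_cases hω : ω ∈ A
      · simpa only [w, if_pos hω, hmem ω hω] using hf v
      · simpa only [w, if_neg hω, Pi.one_apply] using hnotMem ω hω v
    have hw ω : lBoxNorm 4 (w ω - 1) ≤ η := by
      by_cases hω : ω ∈ A
      · simpa only [w, if_pos hω] using hν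
      · simpa only [w, if_neg hω, sub_self, lBoxNorm_zero (show Even 4 by decide)] using
          (lBoxNorm_nonneg (by decide) _).trans hν
    have densified : |boxForm 2 (Function.update h τ fun x => truncate (boxDual τ h x))| ≤
        countErr s ε η k := by
      refine ih (A := A.erase τ) (by rw [Finset.card_erase_of_mem hτ]; omega)
        (fun ω hω => ?_) fun ω hω => ?_
      · rw [Function.update_of_ne (Finset.ne_of_mem_erase hω)]
        exact hmem ω (Finset.mem_of_mem_erase hω)
      · rcases eq_or_ne ω τ with rfl | hne
        · simpa only [Function.update_self] using fun v => abs_truncate_le _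
        · simpa only [Function.update_of_ne hne] using
            hnotMem ω fun h' => hω (Finset.mem_erase.2 ⟨hne, h'⟩)
    refine Real.le_sqrt_of_sq_le ?_
    rw [sq_abs]
    refine (sq_boxForm_two_le hν hhw hw (τ := τ) (by simpa only [hmem τ hτ] using hf)).trans ?_
    gcongr
    · linarith [(lBoxNorm_nonneg (by decide) _).trans hν]
    · exact (le_abs_self _).trans densified

end Counting

section DenseModel

/-- The linear functional `h ↦ 𝔼 x, g x * h x`. -/
noncomputable def expectMul {X : Type*} [Fintype X] (g : X → ℝ) : (X → ℝ) →ₗ[ℝ] ℝ where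
  toFun h := 𝔼 x, g x * h x
  map_add' a b := by simp only [Pi.add_apply, mul_add, Finset.expect_add_distrib]
  map_smul' c a := by
    simp only [Pi.smul_apply, smul_eq_mul, RingHom.id_apply, Finset.mul_expect, mul_left_comm]

theorem expectMul_apply {X : Type*} [Fintype X] (g h : X → ℝ) :
    expectMul g h = 𝔼 x, g x * h x := rfl

theorem mul_mem_convexHull_submonoid {R : Type*} [CommRing R] [Algebra ℝ R] {Φ : Submonoid R}
    {a b : R} (ha : a ∈ convexHull ℝ (Φ : Set R)) (hb : b ∈ convexHull ℝ (Φ : Set R)) :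
    a * b ∈ convexHull ℝ (Φ : Set R) := by
  have mul_generator (φ : R) (hφ : φ ∈ Φ) : a * φ ∈ convexHull ℝ (Φ : Set R) :=
    convexHull_min (t := LinearMap.mulRight ℝ φ ⁻¹' convexHull ℝ Φ)
      (fun _ hψ => subset_convexHull ℝ _ (Φ.mul_mem hψ hφ))
      ((convex_convexHull ℝ _).linear_preimage _) ha
  exact convexHull_min (t := LinearMap.mulLeft ℝ a ⁻¹' convexHull ℝ Φ) mul_generator
    ((convex_convexHull ℝ _).linear_preimage _) hb

theorem pow_mem_convexHull_submonoid {R : Type*} [CommRing R] [Algebra ℝ R] {Φ : Submonoid R}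
    {a : R} (ha : a ∈ convexHull ℝ (Φ : Set R)) (k : ℕ) : a ^ k ∈ convexHull ℝ (Φ : Set R) := by
  induction k with
  | zero => simpa only [pow_zero] using subset_convexHull ℝ _ Φ.one_mem
  | succ k ih => simpa only [pow_succ] using mul_mem_convexHull_submonoid ih ha

theorem abs_le_of_mem_convexHull {E : Type*} [AddCommGroup E] [Module ℝ E] (L : E →ₗ[ℝ] ℝ)
    {Φ : Set E} {c : ℝ} (hL : ∀ φ ∈ Φ, |L φ| ≤ c) {ψ : E} (hψ : ψ ∈ convexHull ℝ Φ) :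
    |L ψ| ≤ c :=
  abs_le.2 <| convexHull_min (t := L ⁻¹' Set.Icc (-c) c) (fun φ hφ => abs_le.1 (hL φ hφ))
    ((convex_Icc _ _).linear_preimage _) hψ

section Minimax

variable {X : Type*} [Fintype X] {F : X → ℝ} {K Φ : Set (X → ℝ)} {ε : ℝ}

theorem exists_mem_convexHull_forall_lt_expect (hK : IsCompact K) (hK_convex : Convex ℝ K)
    (hK_ne : K.Nonempty) (h : ∀ H ∈ K, ∃ φ ∈ Φ, ε < 𝔼 x, (F x - H x) * φ x) :
    ∃ ψ ∈ convexHull ℝ Φ, ∀ H ∈ K, ε < 𝔼 x, (F x - H x) * ψ x := by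
  have continuous_pairing :
      Continuous fun p : (X → ℝ) × (X → ℝ) => 𝔼 x, (F x - p.1 x) * p.2 x := by
    simp only [Fintype.expect_eq_sum_div_card]
    fun_prop
  obtain ⟨T, hT⟩ := hK.elim_finite_subcover
    (fun φ : Φ => {H : X → ℝ | ε < 𝔼 x, (F x - H x) * φ.1 x})
    (fun φ => isOpen_lt continuous_const (continuous_pairing.comp (Continuous.prodMk_left φ.1)))
    fun H hH => by
      obtain ⟨φ, hφ, hlt⟩ := h H hH
      exact Set.mem_iUnion.2 ⟨⟨φ, hφ⟩, hlt⟩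
  have pairing_eq (ψ H : X → ℝ) :
      𝔼 x, (F x - H x) * ψ x = expectMul F ψ - expectMul ψ H := by
    simp only [expectMul_apply, ← Finset.expect_sub_distrib, sub_mul, mul_comm (H _)]
  have convexOn_pairing (ψ : X → ℝ) : ConvexOn ℝ K fun H => 𝔼 x, (F x - H x) * ψ x := by
    simp only [pairing_eq]
    exact (convexOn_const _ hK_convex).sub ((expectMul ψ).concaveOn hK_convex)
  refine Sion.exists_lt_iInf_of_lt_iInf_of_finite (s := Subtype.val '' (T : Set Φ)) hK_ne hK
    (fun ψ _ => (continuous_pairing.comp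
      (Continuous.prodMk_left ψ)).continuousOn.lowerSemicontinuousOn)
    (fun ψ _ => (convexOn_pairing ψ).quasiconvexOn) (convex_convexHull ℝ _)
    (fun H _ => (continuous_pairing.comp
      (Continuous.prodMk_right H)).continuousOn.upperSemicontinuousOn)
    (fun H _ => ((expectMul fun x => F x - H x).concaveOn
      (convex_convexHull ℝ _)).quasiconcaveOn)
    hK_convex (T.finite_toSet.image _) ?_ fun H hH => ?_
  · rintro _ ⟨φ, -, rfl⟩
    exact subset_convexHull ℝ _ φ.2
  · obtain ⟨φ, hφ, hlt⟩ := Set.mem_iUnion₂.1 (hT hH)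
    exact ⟨φ, ⟨φ, hφ, rfl⟩, hlt⟩

end Minimax

section Transference

variable {X : Type*} [Fintype X] {Φ : Submonoid (X → ℝ)} {ν ψ : X → ℝ} {c : ℝ}

theorem abs_expect_mul_eval_le {g : X → ℝ} (hg : ∀ φ ∈ Φ, |𝔼 x, g x * φ x| ≤ c)
    (hψ : ψ ∈ convexHull ℝ (Φ : Set (X → ℝ))) (p : Polynomial ℝ) :
    |𝔼 x, g x * p.eval (ψ x)| ≤ (∑ k ∈ Finset.range (p.natDegree + 1), |p.coeff k|) * c := by
  have expand : 𝔼 x, g x * p.eval (ψ x) =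
      ∑ k ∈ Finset.range (p.natDegree + 1), p.coeff k * expectMul g (ψ ^ k) := by
    simp only [expectMul_apply, Finset.mul_expect, ← Finset.expect_sum_comm,
      Polynomial.eval_eq_sum_range, Finset.mul_sum, Pi.pow_apply, mul_left_comm]
  rw [expand, Finset.sum_mul]
  refine (Finset.abs_sum_le_sum_abs _ _).trans (Finset.sum_le_sum fun k _ => ?_)
  rw [abs_mul]
  gcongr
  exact abs_le_of_mem_convexHull _ hg (pow_mem_convexHull_submonoid hψ k)

theorem abs_expect_sub_one_mul_le [Nonempty X] {a : X → ℝ} (hν : ∀ x, 0 ≤ ν x)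
    (hν_mean : |𝔼 x, (ν x - 1)| ≤ 1) (ha : ∀ x, |a x| ≤ c) :
    |𝔼 x, (ν x - 1) * a x| ≤ 3 * c := by
  have hc : 0 ≤ c := (abs_nonneg _).trans (ha (Classical.arbitrary X))
  calc |𝔼 x, (ν x - 1) * a x| ≤ 𝔼 x, (ν x + 1) * c := by
        refine (Finset.abs_expect_le _ _).trans (Finset.expect_le_expect fun x _ => ?_)
        rw [abs_mul]
        exact mul_le_mul (abs_le.2 ⟨by linarith [hν x], by linarith⟩) (ha x) (abs_nonneg _)
          (by linarith [hν x])
    _ = (𝔼 x, (ν x - 1) + 2) * c := by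
        rw [← Finset.expect_mul, Finset.expect_add_distrib, Finset.expect_sub_distrib,
          Fintype.expect_const]
        ring
    _ ≤ 3 * c := by
        gcongr
        linarith [(abs_le.1 hν_mean).2]

end Transference

theorem exists_abs_expect_sub_one_mul_comp_le {g : ℝ → ℝ} (hg : ContinuousOn g (Set.Icc (-1) 1))
    {ε : ℝ} (hε : 0 < ε) :
    ∃ ε' > 0, ∀ (X : Type u) [Fintype X] [Nonempty X] (Φ : Submonoid (X → ℝ)) (ν : X → ℝ),
      (∀ φ ∈ Φ, ∀ x, |φ x| ≤ 1) → (∀ x, 0 ≤ ν x) → (∀ φ ∈ Φ, |𝔼 x, (ν x - 1) * φ x| ≤ ε') →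
      ∀ ψ ∈ convexHull ℝ (Φ : Set (X → ℝ)), |𝔼 x, (ν x - 1) * g (ψ x)| ≤ ε := by
  obtain ⟨p, hp⟩ := exists_polynomial_near_of_continuousOn (-1) 1 g hg (ε / 6) (by positivity)
  set S := ∑ k ∈ Finset.range (p.natDegree + 1), |p.coeff k|
  have hS : 0 ≤ S := Finset.sum_nonneg fun _ _ => abs_nonneg _
  refine ⟨min 1 (ε / (2 * (1 + S))), by positivity, fun X _ _ Φ ν hΦ hν hνΦ ψ hψ => ?_⟩
  have hψ_le (x : X) : |ψ x| ≤ 1 :=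
    abs_le_of_mem_convexHull (LinearMap.proj x) (fun φ hφ => hΦ φ hφ x) hψ
  have eval_le : |𝔼 x, (ν x - 1) * p.eval (ψ x)| ≤ ε / 2 :=
    calc _ ≤ S * min 1 (ε / (2 * (1 + S))) := abs_expect_mul_eval_le hνΦ hψ p
      _ ≤ (1 + S) * (ε / (2 * (1 + S))) := by
          gcongr
          exacts [by linarith, min_le_right _ _]
      _ = ε / 2 := by field_simp
  have approx_le : |𝔼 x, (ν x - 1) * (p.eval (ψ x) - g (ψ x))| ≤ 3 * (ε / 6) :=
    abs_expect_sub_one_mul_le hν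
      (by simpa using (hνΦ 1 Φ.one_mem).trans (min_le_left _ _))
      fun x => (hp _ (abs_le.1 (hψ_le x))).le
  have decomp : 𝔼 x, (ν x - 1) * g (ψ x) = 𝔼 x, (ν x - 1) * p.eval (ψ x) -
      𝔼 x, (ν x - 1) * (p.eval (ψ x) - g (ψ x)) := by
    simp only [← Finset.expect_sub_distrib, ← mul_sub, sub_sub_cancel]
  rw [decomp]
  linarith [abs_sub (𝔼 x, (ν x - 1) * p.eval (ψ x))
    (𝔼 x, (ν x - 1) * (p.eval (ψ x) - g (ψ x)))]

theorem sub_indicator_mul_le {F ν t : ℝ} (hF : 0 ≤ F) (hFν : F ≤ ν) :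
    (F - if 0 ≤ t then 1 else 0) * t ≤ (ν - 1) * t⁺ := by
  split_ifs with ht
  · rw [posPart_of_nonneg ht]
    gcongr
  · rw [posPart_of_nonpos (not_le.1 ht).le, mul_zero, sub_zero]
    exact mul_nonpos_of_nonneg_of_nonpos hF (not_le.1 ht).le

theorem exists_denseModel_of_nonneg {ε : ℝ} (hε : 0 < ε) :
    ∃ ε' > 0, ∀ (X : Type u) [Fintype X] [Nonempty X] (Φ : Submonoid (X → ℝ)) (ν F : X → ℝ),
      (∀ φ ∈ Φ, ∀ x, |φ x| ≤ 1) → (∀ φ ∈ Φ, -φ ∈ Φ) → (∀ x, 0 ≤ F x) → (∀ x, F x ≤ ν x) →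
      (∀ φ ∈ Φ, |𝔼 x, (ν x - 1) * φ x| ≤ ε') →
      ∃ H : X → ℝ, (∀ x, H x ∈ Set.Icc 0 1) ∧ ∀ φ ∈ Φ, |𝔼 x, (F x - H x) * φ x| ≤ ε := by
  obtain ⟨ε', hε', transfer⟩ := exists_abs_expect_sub_one_mul_comp_le
    (g := fun t => t⁺) (by simp only [posPart_def]; fun_prop) hε
  refine ⟨ε', hε', fun X _ _ Φ ν F hΦ hneg hF hFν hνΦ => ?_⟩
  suffices h : ∃ H ∈ Set.univ.pi fun _ : X => Set.Icc (0 : ℝ) 1,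
      ∀ φ ∈ (Φ : Set (X → ℝ)), 𝔼 x, (F x - H x) * φ x ≤ ε by
    obtain ⟨H, hH, hHφ⟩ := h
    refine ⟨H, fun x => hH x trivial, fun φ hφ => abs_le'.2 ⟨hHφ φ hφ, ?_⟩⟩
    simpa only [Pi.neg_apply, mul_neg, Finset.expect_neg_distrib] using hHφ _ (hneg φ hφ)
  by_contra! no_model
  obtain ⟨ψ, hψ, hψ_lt⟩ := exists_mem_convexHull_forall_lt_expect
    (isCompact_univ_pi fun _ => isCompact_Icc) (convex_pi fun _ _ => convex_Icc _ _)
    ⟨0, fun _ _ => by simp⟩ no_model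
  have indicator_lt := hψ_lt (fun x => if 0 ≤ ψ x then 1 else 0) fun x _ => by
    dsimp only
    split_ifs <;> simp
  refine (indicator_lt.trans_le ?_).not_ge
    ((le_abs_self _).trans (transfer X Φ ν hΦ (fun x => (hF x).trans (hFν x)) hνΦ ψ hψ))
  exact Finset.expect_le_expect fun x _ => sub_indicator_mul_le (hF x) (hFν x)

theorem exists_denseModel {ε : ℝ} (hε : 0 < ε) :
    ∃ ε' > 0, ∀ (X : Type u) [Fintype X] [Nonempty X] (Φ : Submonoid (X → ℝ)) (ν F : X → ℝ),
      (∀ φ ∈ Φ, ∀ x, |φ x| ≤ 1) → (∀ φ ∈ Φ, -φ ∈ Φ) → (∀ x, |F x| ≤ ν x) →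
      (∀ φ ∈ Φ, |𝔼 x, (ν x - 1) * φ x| ≤ ε') →
      ∃ H : X → ℝ, (∀ x, H x ∈ Set.Icc (-1) 1) ∧ ((∀ x, 0 ≤ F x) → ∀ x, 0 ≤ H x) ∧
        ∀ φ ∈ Φ, |𝔼 x, (F x - H x) * φ x| ≤ ε := by
  obtain ⟨ε', hε', model⟩ := exists_denseModel_of_nonneg (half_pos hε)
  refine ⟨ε', hε', fun X _ _ Φ ν F hΦ hneg hF hνΦ => ?_⟩
  obtain ⟨H, hH, hHφ⟩ := model X Φ ν F⁺ hΦ hneg (fun x => posPart_nonneg (F x))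
    (fun x => (sup_le (le_abs_self _) (abs_nonneg _)).trans (hF x)) hνΦ
  by_cases hF_nonneg : ∀ x, 0 ≤ F x
  · rw [posPart_of_nonneg hF_nonneg] at hHφ
    exact ⟨H, fun x => ⟨by linarith [(hH x).1], (hH x).2⟩, fun _ x => (hH x).1,
      fun φ hφ => (hHφ φ hφ).trans (half_le_self hε.le)⟩
  obtain ⟨H', hH', hHφ'⟩ := model X Φ ν F⁻ hΦ hneg (fun x => negPart_nonneg (F x))
    (fun x => (sup_le (neg_le_abs _) (abs_nonneg _)).trans (hF x)) hνΦ
  refine ⟨H - H', fun x => ⟨?_, ?_⟩, fun h => absurd h hF_nonneg, fun φ hφ => ?_⟩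
  · simpa using sub_le_sub (hH x).1 (hH' x).2
  · simpa using sub_le_sub (hH x).2 (hH' x).1
  have decomp : 𝔼 x, (F x - (H - H') x) * φ x =
      𝔼 x, (F⁺ x - H x) * φ x - 𝔼 x, (F⁻ x - H' x) * φ x := by
    rw [← Finset.expect_sub_distrib]
    refine Finset.expect_congr rfl fun x _ => ?_
    rw [Pi.sub_apply, Pi.posPart_apply, Pi.negPart_apply]
    linear_combination -φ x * posPart_sub_negPart (F x)
  rw [decomp]
  linarith [abs_sub (𝔼 x, (F⁺ x - H x) * φ x) (𝔼 x, (F⁻ x - H' x) * φ x), hHφ φ hφ, hHφ' φ hφ]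

end DenseModel

section Rate

theorem exists_tendsto_zero_of_eventually {P : ℝ → ℝ → Prop} (mono : ∀ η, Monotone (P η))
    (exists_bound : ∀ η, ∃ d, P η d) (small : ∀ ε > 0, ∀ᶠ η in 𝓝[>] (0 : ℝ), P η ε) :
    ∃ δ : ℝ → ℝ, Tendsto δ (𝓝[>] 0) (𝓝 0) ∧ ∀ η > 0, P η (δ η) := by
  let best (η : ℝ) : ℝ := sInf {d | 0 ≤ d ∧ P η d}
  have bddBelow (η : ℝ) : BddBelow {d | 0 ≤ d ∧ P η d} := ⟨0, fun _ hd => hd.1⟩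
  have tendsto_best : Tendsto best (𝓝[>] 0) (𝓝 0) := by
    refine tendsto_order.2 ⟨fun a ha => Eventually.of_forall fun η =>
      ha.trans_le (Real.sInf_nonneg fun d hd => hd.1), fun a ha => ?_⟩
    filter_upwards [small (a / 2) (half_pos ha)] with η hη
    exact (csInf_le (bddBelow η) ⟨(half_pos ha).le, hη⟩).trans_lt (half_lt_self ha)
  -- the infimum need not be attained, so the rate is `best` plus a positive null term
  refine ⟨fun η => best η + η, ?_, fun η hη => ?_⟩
  · simpa using tendsto_best.add (tendsto_nhdsWithin_of_tendsto_nhds (tendsto_id (α := ℝ)))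
  · obtain ⟨M, hM⟩ := exists_bound η
    obtain ⟨d, hd, hlt⟩ := exists_lt_of_csInf_lt
      (show {d | 0 ≤ d ∧ P η d}.Nonempty from
        ⟨max M 0, le_max_right _ _, mono η (le_max_left _ _) hM⟩) (lt_add_of_pos_right (best η) hη)
    exact mono η hlt.le hd.2

theorem continuous_linearFormsErr (s : ℕ) : Continuous (linearFormsErr s) := by
  unfold linearFormsErr
  fun_prop

theorem linearFormsErr_zero (s : ℕ) : linearFormsErr s 0 = 0 := by simp [linearFormsErr]

theorem continuous_countErr (s k : ℕ) : Continuous fun p : ℝ × ℝ => countErr s p.1 p.2 k := by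
  induction k with
  | zero => exact continuous_fst
  | succ k ih =>
    have := continuous_linearFormsErr s
    simp only [countErr, densifyErr]
    fun_prop

theorem countErr_zero_zero (s k : ℕ) : countErr s 0 0 k = 0 := by
  induction k with
  | zero => rfl
  | succ k ih => simp [countErr, densifyErr, linearFormsErr_zero, ih]

theorem exists_eventually_countErr_lt (s k : ℕ) {c : ℝ} (hc : 0 < c) :
    ∃ ε > 0, ∀ᶠ η in 𝓝[>] (0 : ℝ), countErr s ε η k < c := by
  have joint : ∀ᶠ p in 𝓝 (0 : ℝ) ×ˢ 𝓝 (0 : ℝ), countErr s p.1 p.2 k < c := by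
    rw [← nhds_prod_eq]
    refine (continuous_countErr s k).continuousAt.eventually_lt continuousAt_const ?_
    simpa only [countErr_zero_zero] using hc
  obtain ⟨ε, hε, hη⟩ := ((joint.curry.filter_mono nhdsWithin_le_nhds).and
    (self_mem_nhdsWithin (s := Set.Ioi 0))).exists
  exact ⟨ε, hη, hε.filter_mono nhdsWithin_le_nhds⟩

end Rate

section BoundedModels

variable {s : ℕ} {η d : ℝ}

/-- Every function on some `V^s` majorized by a weight that is `η`-close to `1` in `4`-box norm is
`d`-close in box norm to a `[-1, 1]`-valued function, which is nonnegative if the given one is. -/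
def HasBoundedModels (s : ℕ) (η d : ℝ) : Prop :=
  ∀ (V : Type u) [Fintype V] [Nonempty V] (ν : (Fin s → V) → ℝ), lBoxNorm 4 (ν - 1) ≤ η →
    ∀ F : (Fin s → V) → ℝ, (∀ v, |F v| ≤ ν v) →
      ∃ H : (Fin s → V) → ℝ, (∀ v, H v ∈ Set.Icc (-1) 1) ∧ boxNorm (F - H) ≤ d ∧
        ((∀ v, 0 ≤ F v) → ∀ v, 0 ≤ H v)

theorem HasBoundedModels.monotone : Monotone (HasBoundedModels.{u} s η) := by
  intro d d' hdd' h V _ _ ν hν F hF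
  obtain ⟨H, hH, hFH, hH_nonneg⟩ := h V ν hν F hF
  exact ⟨H, hH, hFH.trans hdd', hH_nonneg⟩

theorem hasBoundedModels_one_add [NeZero s] (η : ℝ) : HasBoundedModels.{u} s η (1 + η) := by
  intro V _ _ ν hν F hF
  refine ⟨0, by simp, ?_, fun _ _ => le_rfl⟩
  rw [sub_zero]
  exact (boxNorm_le_lBoxNorm_four F).trans
    ((lBoxNorm_le_of_abs_le (by decide) hF).trans (lBoxNorm_le_one_add (by decide) hν))

section Cut

variable {V : Type*} [Fintype V] [Nonempty V] [NeZero s] {ν f F H : (Fin s → V) → ℝ} {ε c : ℝ}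

theorem boxNorm_le_of_cut (hν : lBoxNorm 4 (ν - 1) ≤ η) (hf : ∀ v, |f v| ≤ ν v)
    (hε : ∀ φ ∈ cutFunctions V s, |𝔼 v, f v * φ v| ≤ ε) (hc : 0 ≤ c)
    (hcount : countErr s ε η (2 ^ s - 1) ≤ c ^ 2 ^ s) : boxNorm f ≤ c := by
  refine lBoxNorm_le_of_boxForm_le even_two hc (((le_abs_self _).trans ?_).trans hcount)
  refine abs_boxForm_two_le_countErr hν hf hε (A := Finset.univ) ?_ (fun _ _ => rfl) (by simp)
  rw [Nat.sub_add_cancel Nat.one_le_two_pow]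
  simp

theorem boxNorm_sub_le_of_cut (hν : lBoxNorm 4 (ν - 1) ≤ η) (hF : ∀ v, |F v| ≤ ν v)
    (hH : ∀ v, |H v| ≤ 1) (hε : ∀ φ ∈ cutFunctions V s, |𝔼 v, (F v - H v) * φ v| ≤ ε)
    (hd : 0 ≤ d) (hcount : countErr s ε η (2 ^ s - 1) ≤ (d / 2) ^ 2 ^ s) :
    boxNorm (F - H) ≤ d := by
  -- `(F - H) / 2` is majorized by `(ν + 1) / 2`, which is even closer to `1` than `ν`
  have half_close : lBoxNorm 4 ((2⁻¹ : ℝ) • (ν + 1) - 1) ≤ η := by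
    have : (2⁻¹ : ℝ) • (ν + 1) - 1 = (2⁻¹ : ℝ) • (ν - 1) := by
      funext v
      simp only [Pi.sub_apply, Pi.smul_apply, Pi.add_apply, Pi.one_apply, smul_eq_mul]
      ring
    rw [this, lBoxNorm_smul_of_nonneg (by decide) (by norm_num)]
    linarith [lBoxNorm_nonneg (ℓ := 4) (by decide) (ν - 1)]
  have half_le (v : Fin s → V) : |((2⁻¹ : ℝ) • (F - H)) v| ≤ ((2⁻¹ : ℝ) • (ν + 1)) v := by
    rw [Pi.smul_apply, smul_eq_mul, abs_mul, abs_of_pos (by norm_num)]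
    exact mul_le_mul_of_nonneg_left ((abs_sub _ _).trans (add_le_add (hF v) (hH v)))
      (by norm_num)
  have half_cut (φ) (hφ : φ ∈ cutFunctions V s) :
      |𝔼 v, ((2⁻¹ : ℝ) • (F - H)) v * φ v| ≤ ε := by
    simp only [Pi.smul_apply, Pi.sub_apply, smul_eq_mul, mul_assoc, ← Finset.mul_expect]
    rw [abs_mul, abs_of_pos (by norm_num)]
    linarith [hε φ hφ, abs_nonneg (𝔼 v, (F v - H v) * φ v)]
  have half_bound := boxNorm_le_of_cut half_close half_le half_cut (by positivity) hcount
  rw [boxNorm, lBoxNorm_smul_of_nonneg even_two (by norm_num)] at half_bound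
  rw [boxNorm]
  linarith

end Cut

theorem eventually_hasBoundedModels [NeZero s] (hd : 0 < d) :
    ∀ᶠ η in 𝓝[>] 0, HasBoundedModels.{u} s η d := by
  obtain ⟨ε, hε, small_count⟩ := exists_eventually_countErr_lt s (2 ^ s - 1)
    (show 0 < (d / 2) ^ 2 ^ s by positivity)
  obtain ⟨ε', hε', model⟩ := exists_denseModel.{u} hε
  filter_upwards [small_count, Ioc_mem_nhdsGT hε'] with η hcount hη V _ _ ν hν F hF
  obtain ⟨H, hH, hH_nonneg, hFH⟩ := model (Fin s → V) (cutFunctions V s) ν F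
    (fun φ => abs_le_one_of_mem_cutFunctions) (fun φ => neg_mem_cutFunctions) hF
    fun φ hφ => (abs_expect_mul_le_of_mem_cutFunctions (ν - 1) hφ).trans (hν.trans hη.2)
  exact ⟨H, hH, boxNorm_sub_le_of_cut hν hF (fun v => abs_le.2 (hH v)) hFH hd.le hcount.le,
    hH_nonneg⟩

end BoundedModels

theorem corollary4p5 (s : ℕ) (hs : 2 ≤ s) :
    ∃ δ : ℝ → ℝ, Tendsto δ (𝓝[>] 0) (𝓝 0) ∧
      ∀ (V : Type u) [Fintype V] [Nonempty V] (η : ℝ), 0 < η → η ≤ 1 →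
        ∀ ν : (Fin s → V) → ℝ, (∀ v, 0 ≤ ν v) →
          lBoxNorm 4 (fun v => ν v - 1) ≤ η →
            ∀ F : (Fin s → V) → ℝ, (∀ v, |F v| ≤ ν v) →
              ∃ H : (Fin s → V) → ℝ,
                (∀ v, H v ∈ Set.Icc (-1 : ℝ) 1) ∧
                boxNorm (fun v => F v - H v) ≤ δ η ∧
                ((∀ v, 0 ≤ F v) → ∀ v, 0 ≤ H v) := by
  have : NeZero s := ⟨by omega⟩
  obtain ⟨δ, tendsto_δ, hδ⟩ := exists_tendsto_zero_of_eventually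
    (fun _ => HasBoundedModels.monotone.{u} (s := s)) (fun η => ⟨_, hasBoundedModels_one_add η⟩)
    fun _ => eventually_hasBoundedModels
  exact ⟨δ, tendsto_δ, fun V _ _ η hη _ ν _ hν F hF => hδ η hη V ν hν F hF⟩
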